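/- Let $M\ge 1$ be an integer and let $0\le\rho_1\le\cdots\le\rho_{M-1}\le\rho_M=1$ be real numbers. For every integer $L\ge 1$ and $1\le j\le M$ put $r_j=r_j^{(L)}=\lfloor 2^{\rho_j L}\rfloor$, and let $\omega_r=e^{2\pi i/r}$. Let $p_k$ denote the $k$-th prime number ($p_1=2$), and put $$k^{(j)}_i=(M+j-1)2^L+i\qquad (1\le j\le M,\ 0\le i\le r_j-1).$$ Let $\Pi_L^\times$ be the set of all integers $$n=p_{k^{(1)}_{i_1}}p_{k^{(2)}_{i_2}}\cdots p_{k^{(M)}_{i_M}},\qquad 0\le i_j\le r_j-1 ;$$ each integer $n\ge1$ has at most one such representation, with at most one $L$. Let $$X=(\rho_1+\cdots+\rho_M)\,\frac{M+1}{2M},$$ let $\beta_1,\beta_2,\dots$ be any complex numbers with $|\beta_L|=1$, and define $$a_n=\begin{cases}\beta_L\,2^{-XL}\,\omega_{r_2}^{i_1i_2}\omega_{r_3}^{i_2i_3}\cdots\omega_{r_M}^{i_{M-1}i_M}&\text{if } n=p_{k^{(1)}_{i_1}}\cdots p_{k^{(M)}_{i_M}}\in\Pi_L^\times\text{ for some }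 L\ge 1,\\ 0&\text{otherwise.}\end{cases}$$ Then the Dirichlet series $f(s)=\sum_{n=1}^\infty a_n n^{-s}$ satisfies $\sigma_b\ge 0$, where $$\sigma_b=\inf\Big\{\sigma\in\mathbb R:\ \sum_{n=1}^\infty a_n n^{-s}\text{ converges to a bounded function on }\{s\in\mathbb C:\operatorname{Re}s>\sigma\}\Big\}.$$ -/

import Mathlib

open Filter Topology

noncomputable section

namespace DirichletWalsh

/-! ### Dirichlet series and the abscissa of boundedness -/

/-- The Dirichlet series `∑ a n * n ^ (-s)`, `n ≥ 1`, converges (possibly only conditionally) at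
every point of the open half plane `σ < re s`, and its sum is a bounded function there. -/
def ConvergesBoundedly (a : ℕ → ℂ) (σ : ℝ) : Prop :=
  ∃ (f : ℂ → ℂ) (C : ℝ), ∀ s : ℂ, σ < s.re →
    Tendsto (fun N : ℕ => ∑ n ∈ Finset.Icc 1 N, a n * (n : ℂ) ^ (-s)) atTop (𝓝 (f s)) ∧
      ‖f s‖ ≤ C

/-- The abscissa `σ_b`, as an extended real number: the infimum of all real `σ` such that the
Dirichlet series converges to a bounded function on the half plane `σ < re s`. -/
def sigmaB (a : ℕ → ℂ) : EReal :=
  sInf (Real.toEReal '' {σ : ℝ | ConvergesBoundedly a σ})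

/-! ### The construction

The index `j : Fin M` is the usual index `j ∈ {1, …, M}` shifted down by one. -/

/-- `r_j = ⌊2 ^ (ρ_j L)⌋`. -/
def size {M : ℕ} (ρ : Fin M → ℝ) (L : ℕ) (j : Fin M) : ℕ := ⌊(2 : ℝ) ^ (ρ j * L)⌋₊

/-- The `k`-th prime number, for `k ≥ 1`, so that `kthPrime 1 = 2`. -/
def kthPrime (k : ℕ) : ℕ := Nat.nth Nat.Prime (k - 1)

/-- The primitive root of unity `ω_r = exp (2 π i / r)`. -/
def rootOfUnity (r : ℕ) : ℂ := Complex.exp (2 * Real.pi * Complex.I / r)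

/-- The multi-indices `(i_1, …, i_M)` with `0 ≤ i_j < r_j`, at level `L`. -/
abbrev MultiIndex {M : ℕ} (ρ : Fin M → ℝ) (L : ℕ) : Type := (j : Fin M) → Fin (size ρ L j)

/-- The index of the prime chosen by the entry `i_j` of a multi-index: with `j` running from `1`
to `M` it is `(M + j - 1) 2 ^ L + i_j`. -/
def primeIndex {M : ℕ} (ρ : Fin M → ℝ) (L : ℕ) (i : MultiIndex ρ L) (j : Fin M) : ℕ :=
  (M + (j : ℕ)) * 2 ^ L + (i j : ℕ)

/-- The integer that belongs to a multi-index: the product over `j` of the primes with index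
`(M + j - 1) 2 ^ L + i_j`. -/
def primeProduct {M : ℕ} (ρ : Fin M → ℝ) (L : ℕ) (i : MultiIndex ρ L) : ℕ :=
  ∏ j : Fin M, kthPrime (primeIndex ρ L i j)

/-- The product of the roots of unity `ω_{r_j} ^ (i_{j-1} i_j)` over `j = 2, …, M`
(an empty product if `M = 1`). -/
def walshPhase {M : ℕ} (ρ : Fin M → ℝ) (L : ℕ) (i : MultiIndex ρ L) : ℂ :=
  ∏ j : Fin (M - 1),
    rootOfUnity (size ρ L ⟨(j : ℕ) + 1, by omega⟩) ^
      ((i ⟨(j : ℕ), by omega⟩ : ℕ) * (i ⟨(j : ℕ) + 1, by omega⟩ : ℕ))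

open Classical in
/-- The coefficients `a_n` of the series: if `n` is the integer of a multi-index at a level
`L ≥ 1`, then `a_n = β_L 2 ^ (-X L) ∏ ω_{r_j} ^ (i_{j-1} i_j)`, and otherwise `a_n = 0`.
The level and the multi-index are determined by `n`, see `primeProduct_inj`. -/
def coeff {M : ℕ} (ρ : Fin M → ℝ) (X : ℝ) (β : ℕ → ℂ) (n : ℕ) : ℂ :=
  if h : ∃ q : (L : ℕ) × MultiIndex ρ L, 1 ≤ q.1 ∧ primeProduct ρ q.1 q.2 = n then
    β h.choose.1 * (((2 : ℝ) ^ (-(X * (h.choose.1 : ℝ))) : ℝ) : ℂ) *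
      walshPhase ρ h.choose.1 h.choose.2
  else 0

/-! ### The coefficients are well defined -/

theorem size_le {M : ℕ} {ρ : Fin M → ℝ} (hρ : ∀ j, ρ j ≤ 1) (L : ℕ) (j : Fin M) :
    size ρ L j ≤ 2 ^ L := by
  have h : (2 : ℝ) ^ (ρ j * L) ≤ ((2 ^ L : ℕ) : ℝ) := by
    calc (2 : ℝ) ^ (ρ j * L) ≤ (2 : ℝ) ^ (L : ℝ) := by
          apply Real.rpow_le_rpow_of_exponent_le (by norm_num)
          have := mul_le_mul_of_nonneg_right (hρ j) (Nat.cast_nonneg (α := ℝ) L)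
          simpa using this
      _ = ((2 ^ L : ℕ) : ℝ) := by rw [Real.rpow_natCast]; push_cast; rfl
  exact Nat.floor_le_of_le h

theorem kthPrime_prime (k : ℕ) : (kthPrime k).Prime :=
  Nat.prime_nth_prime (k - 1)

theorem kthPrime_inj {k l : ℕ} (hk : 1 ≤ k) (hl : 1 ≤ l) (h : kthPrime k = kthPrime l) :
    k = l := by
  have := Nat.nth_injective Nat.infinite_setOfPred_prime h
  omega

theorem level_le {M L L' j j' x x' : ℕ} (hj : j < M) (hx : x < 2 ^ L)
    (h : (M + j) * 2 ^ L + x = (M + j') * 2 ^ L' + x') : L' ≤ L := by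
  by_contra hc
  have h1 : 2 ^ (L + 1) ≤ 2 ^ L' := Nat.pow_le_pow_right (by norm_num) (by omega)
  rw [pow_succ] at h1
  have h2 : (M + j + 1) * 2 ^ L ≤ (2 * M) * 2 ^ L := Nat.mul_le_mul_right _ (by omega)
  have h3 : M * (2 ^ L * 2) ≤ M * 2 ^ L' := Nat.mul_le_mul_left _ h1
  nlinarith [Nat.zero_le (j' * 2 ^ L')]

/-- Distinct levels or multi-indices give distinct integers. -/
theorem primeProduct_inj {M : ℕ} (hM : 1 ≤ M) {ρ : Fin M → ℝ} (hρ : ∀ j, ρ j ≤ 1)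
    (q q' : (L : ℕ) × MultiIndex ρ L)
    (h : primeProduct ρ q.1 q.2 = primeProduct ρ q'.1 q'.2) : q = q' := by
  obtain ⟨L, i⟩ := q
  obtain ⟨L', i'⟩ := q'
  simp only at h
  have hlt : ∀ (L : ℕ) (i : MultiIndex ρ L) (j : Fin M), (i j : ℕ) < 2 ^ L :=
    fun L i j => lt_of_lt_of_le (i j).2 (size_le hρ L j)
  have hpos : ∀ (L : ℕ) (i : MultiIndex ρ L) (j : Fin M), 1 ≤ primeIndex ρ L i j := by
    intro L i j
    have : 0 < (M + (j : ℕ)) * 2 ^ L := by positivity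
    unfold primeIndex
    omega
  have key : ∀ j : Fin M, ∃ j' : Fin M, primeIndex ρ L i j = primeIndex ρ L' i' j' := by
    intro j
    have hd : kthPrime (primeIndex ρ L i j) ∣ primeProduct ρ L' i' := by
      rw [← h]
      exact Finset.dvd_prod_of_mem _ (Finset.mem_univ j)
    obtain ⟨j', -, hj'⟩ := (kthPrime_prime _).prime.exists_mem_finset_dvd hd
    exact ⟨j', kthPrime_inj (hpos _ _ _) (hpos _ _ _)
      ((Nat.prime_dvd_prime_iff_eq (kthPrime_prime _) (kthPrime_prime _)).1 hj')⟩
  obtain ⟨j', h0⟩ := key ⟨0, hM⟩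
  have hL : L = L' :=
    le_antisymm (level_le j'.2 (hlt L' i' j') h0.symm) (level_le hM (hlt L i ⟨0, hM⟩) h0)
  subst hL
  congr 1
  funext j
  obtain ⟨j', hj⟩ := key j
  unfold primeIndex at hj
  have h1 := hlt L i j
  have h2 := hlt L i' j'
  have hjj : (j : ℕ) = j' := by
    have e1 : ((M + (j : ℕ)) * 2 ^ L + (i j : ℕ)) / 2 ^ L = M + j := by
      rw [mul_comm, Nat.mul_add_div (by positivity), Nat.div_eq_of_lt h1, add_zero]
    have e2 : ((M + (j' : ℕ)) * 2 ^ L + (i' j' : ℕ)) / 2 ^ L = M + j' := by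
      rw [mul_comm, Nat.mul_add_div (by positivity), Nat.div_eq_of_lt h2, add_zero]
    rw [hj, e2] at e1
    omega
  have hjj' : j = j' := Fin.ext hjj
  subst hjj'
  apply Fin.ext
  omega

/-- The defining formula of the coefficients, free of choices. -/
theorem coeff_primeProduct {M : ℕ} (hM : 1 ≤ M) {ρ : Fin M → ℝ} (hρ : ∀ j, ρ j ≤ 1) (X : ℝ)
    (β : ℕ → ℂ) {L : ℕ} (hL : 1 ≤ L) (i : MultiIndex ρ L) :
    coeff ρ X β (primeProduct ρ L i) =
      β L * (((2 : ℝ) ^ (-(X * (L : ℝ))) : ℝ) : ℂ) * walshPhase ρ L i := by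
  have h : ∃ q : (L : ℕ) × MultiIndex ρ L,
      1 ≤ q.1 ∧ primeProduct ρ q.1 q.2 = primeProduct ρ L i := ⟨⟨L, i⟩, hL, rfl⟩
  have hq : h.choose = ⟨L, i⟩ := primeProduct_inj hM hρ _ _ h.choose_spec.2
  unfold coeff
  rw [dif_pos h, hq]

theorem coeff_eq_zero {M : ℕ} (ρ : Fin M → ℝ) (X : ℝ) (β : ℕ → ℂ) {n : ℕ}
    (h : ∀ L, 1 ≤ L → ∀ i : MultiIndex ρ L, primeProduct ρ L i ≠ n) : coeff ρ X β n = 0 := by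
  unfold coeff
  rw [dif_neg]
  rintro ⟨⟨L, i⟩, hL, hn⟩
  exact h L hL i hn

end DirichletWalsh

end

/-! If `∑ a n * n ^ (-s)` is bounded by `C` on a half plane containing the imaginary axis, averaging
it over that axis against a Riesz product `∏ (1 + re (z_q p_q ^ (it)))` over finitely many primes
`p_q`, with `‖z_q‖ ≤ 1`, gives `∑ (∏ z_q / 2) * a (∏ p_q)`, a sum over sets of primes. The Riesz
product is nonnegative with mean `1`, so this multilinear form in the `z_q` is bounded by `C`.
Conversely, Khinchine's inequality in one block of variables after another, and exact phases in the
block of the largest `ρ_j`, produce weights for which a form with coefficients of equal modulus is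
large. With `X ≤ (∑ ρ_j + ρ_M) / 2` the two bounds agree up to a constant. If `σ_b` were negative
there would be room to take `‖z_q‖ ≤ p_q ^ δ` with `δ > 0`, and the form at level `L` would gain a
factor `2 ^ (δ M L)`.
-/

section Khinchine

variable {E : Type*} [NormedAddCommGroup E]

/-- A Bellman function for the `L¹` Khinchine inequality at scale `q`: `x` stands for the part of a
random sign sum `∑ i, ε i • v i` that is already fixed and `Q` for the sum of the `‖v i‖ ^ 2` that
are still to come. It is the expectation of `‖y‖ ^ 2 / q - ‖y‖ ^ 4 / (4 * q ^ 3) ≤ ‖y‖` at the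
completed sum `y`, with the fourth moment replaced by its Gaussian upper bound. -/
noncomputable def khinchineBellman (q : ℝ) (x : E) (Q : ℝ) : ℝ :=
  q⁻¹ * (‖x‖ ^ 2 + Q) - q⁻¹ ^ 3 / 4 * (‖x‖ ^ 4 + 6 * ‖x‖ ^ 2 * Q + 3 * Q ^ 2)

theorem khinchineBellman_zero_right_le_norm {q : ℝ} (hq : 0 ≤ q) (x : E) :
    khinchineBellman q x 0 ≤ ‖x‖ := by
  obtain rfl | hq := hq.eq_or_lt
  · simp [khinchineBellman]
  have hcubic : 0 ≤ (‖x‖ / q) ^ 3 - 4 * (‖x‖ / q) + 4 := by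
    have : 0 ≤ ‖x‖ / q := by positivity
    nlinarith [mul_nonneg this (sq_nonneg (‖x‖ / q - 1)), sq_nonneg (2 * (‖x‖ / q) - 2)]
  have : ‖x‖ - khinchineBellman q x 0 = ‖x‖ / 4 * ((‖x‖ / q) ^ 3 - 4 * (‖x‖ / q) + 4) := by
    unfold khinchineBellman
    field_simp
    ring
  nlinarith [mul_nonneg (norm_nonneg x) hcubic]

theorem khinchineBellman_sqrt_zero_left {Q : ℝ} (hQ : 0 ≤ Q) :
    khinchineBellman √Q (0 : E) Q = √Q / 4 := by
  obtain rfl | hQ := hQ.eq_or_lt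
  · simp [khinchineBellman]
  obtain ⟨r, hr, rfl⟩ : ∃ r : ℝ, 0 < r ∧ Q = r ^ 2 :=
    ⟨√Q, Real.sqrt_pos.2 hQ, (Real.sq_sqrt hQ.le).symm⟩
  rw [Real.sqrt_sq hr.le, khinchineBellman, norm_zero]
  field_simp
  ring

variable [InnerProductSpace ℝ E]

theorem norm_add_pow_four_add_norm_sub_pow_four_le (x y : E) :
    ‖x + y‖ ^ 4 + ‖x - y‖ ^ 4 ≤ 2 * ‖x‖ ^ 4 + 12 * ‖x‖ ^ 2 * ‖y‖ ^ 2 + 2 * ‖y‖ ^ 4 := by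
  have hadd := norm_add_sq_real x y
  have hsub := norm_sub_sq_real x y
  have hinner : inner ℝ x y ^ 2 ≤ ‖x‖ ^ 2 * ‖y‖ ^ 2 := by
    rw [← mul_pow, ← sq_abs]
    gcongr
    exact abs_real_inner_le_norm x y
  calc ‖x + y‖ ^ 4 + ‖x - y‖ ^ 4 = (‖x + y‖ ^ 2) ^ 2 + (‖x - y‖ ^ 2) ^ 2 := by ring
    _ = 2 * ‖x‖ ^ 4 + 4 * ‖x‖ ^ 2 * ‖y‖ ^ 2 + 2 * ‖y‖ ^ 4 + 8 * inner ℝ x y ^ 2 := by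
      rw [hadd, hsub]
      ring
    _ ≤ 2 * ‖x‖ ^ 4 + 12 * ‖x‖ ^ 2 * ‖y‖ ^ 2 + 2 * ‖y‖ ^ 4 := by linarith

theorem two_mul_khinchineBellman_le {q : ℝ} (hq : 0 ≤ q) (x v : E) (Q : ℝ) :
    2 * khinchineBellman q x (‖v‖ ^ 2 + Q) ≤
      khinchineBellman q (x + v) Q + khinchineBellman q (x - v) Q := by
  have hsq : ‖x + v‖ ^ 2 + ‖x - v‖ ^ 2 = 2 * (‖x‖ ^ 2 + ‖v‖ ^ 2) := by
    linear_combination norm_add_sq_real x v + norm_sub_sq_real x v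
  have hfour : ‖x + v‖ ^ 4 + ‖x - v‖ ^ 4 ≤
      2 * ‖x‖ ^ 4 + 12 * ‖x‖ ^ 2 * ‖v‖ ^ 2 + 6 * ‖v‖ ^ 4 := by
    linarith [norm_add_pow_four_add_norm_sub_pow_four_le x v, pow_nonneg (norm_nonneg v) 4]
  have := mul_le_mul_of_nonneg_left hfour (by positivity : 0 ≤ q⁻¹ ^ 3 / 4)
  unfold khinchineBellman
  linear_combination this + (6 * (q⁻¹ ^ 3 / 4) * Q - q⁻¹) * hsq

variable {κ ι : Type*} [Fintype κ] (v : κ → ι → E)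

theorem exists_signs_sum_khinchineBellman_le {q : κ → ℝ} (hq : ∀ k, 0 ≤ q k) (s : Finset ι)
    (x : κ → E) :
    ∃ ε : ι → ℝ, (∀ i, |ε i| = 1) ∧
      ∑ k, khinchineBellman (q k) (x k) (∑ i ∈ s, ‖v k i‖ ^ 2) ≤
        ∑ k, khinchineBellman (q k) (x k + ∑ i ∈ s, ε i • v k i) 0 := by
  classical
  induction s using Finset.induction_on generalizing x with
  | empty => exact ⟨fun _ => 1, fun _ => abs_one, by simp⟩
  | insert i s hi ih =>
    have hsplit : ∃ η : ℝ, |η| = 1 ∧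
        ∑ k, khinchineBellman (q k) (x k) (∑ j ∈ insert i s, ‖v k j‖ ^ 2) ≤
          ∑ k, khinchineBellman (q k) (x k + η • v k i) (∑ j ∈ s, ‖v k j‖ ^ 2) := by
      by_contra! h
      have hplus := h 1 abs_one
      have hminus := h (-1) (by simp)
      have := Finset.sum_le_sum fun k (_ : k ∈ Finset.univ) =>
        two_mul_khinchineBellman_le (hq k) (x k) (v k i) (∑ j ∈ s, ‖v k j‖ ^ 2)
      simp only [Finset.sum_insert hi, one_smul, neg_one_smul, ← sub_eq_add_neg] at hplus hminus
      rw [← Finset.mul_sum, Finset.sum_add_distrib] at this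
      linarith
    obtain ⟨η, hη, hle⟩ := hsplit
    obtain ⟨ε, hε, hεle⟩ := ih fun k => x k + η • v k i
    refine ⟨Function.update ε i η, fun j => ?_, hle.trans (hεle.trans_eq ?_)⟩
    · obtain rfl | hj := eq_or_ne j i
      · simpa using hη
      · simpa [hj] using hε j
    · refine Finset.sum_congr rfl fun k _ => ?_
      rw [Finset.sum_insert hi, Function.update_self, ← add_assoc]
      congr 2
      refine Finset.sum_congr rfl fun j hj => ?_
      rw [Function.update_of_ne (ne_of_mem_of_not_mem hj hi)]

variable [Fintype ι]

theorem exists_signs_sum_sqrt_le :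
    ∃ ε : ι → ℝ, (∀ i, |ε i| = 1) ∧
      ∑ k, √(∑ i, ‖v k i‖ ^ 2) ≤ 4 * ∑ k, ‖∑ i, ε i • v k i‖ := by
  obtain ⟨ε, hε, h⟩ := exists_signs_sum_khinchineBellman_le v
    (fun k => Real.sqrt_nonneg (∑ i, ‖v k i‖ ^ 2)) Finset.univ 0
  refine ⟨ε, hε, ?_⟩
  rw [← div_le_iff₀' (by norm_num), Finset.sum_div]
  calc ∑ k, √(∑ i, ‖v k i‖ ^ 2) / 4
      = ∑ k, khinchineBellman √(∑ i, ‖v k i‖ ^ 2) (0 : E) (∑ i, ‖v k i‖ ^ 2) :=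
        Finset.sum_congr rfl fun k _ => (khinchineBellman_sqrt_zero_left (by positivity)).symm
    _ ≤ ∑ k, khinchineBellman √(∑ i, ‖v k i‖ ^ 2) (0 + ∑ i, ε i • v k i) 0 := h
    _ ≤ ∑ k, ‖∑ i, ε i • v k i‖ := by
        refine Finset.sum_le_sum fun k _ => ?_
        rw [zero_add]
        exact khinchineBellman_zero_right_le_norm (Real.sqrt_nonneg _) _

theorem exists_signs_sum_sum_norm_le :
    ∃ ε : ι → ℝ, (∀ i, |ε i| = 1) ∧
      ∑ k, ∑ i, ‖v k i‖ ≤ 4 * √(Fintype.card ι) * ∑ k, ‖∑ i, ε i • v k i‖ := by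
  obtain ⟨ε, hε, h⟩ := exists_signs_sum_sqrt_le v
  refine ⟨ε, hε, ?_⟩
  calc ∑ k, ∑ i, ‖v k i‖ ≤ ∑ k, √(Fintype.card ι) * √(∑ i, ‖v k i‖ ^ 2) := by
        refine Finset.sum_le_sum fun k _ => ?_
        rw [← Real.sqrt_mul (Nat.cast_nonneg _)]
        exact Real.le_sqrt_of_sq_le (sq_sum_le_card_mul_sum_sq (s := Finset.univ))
    _ = √(Fintype.card ι) * ∑ k, √(∑ i, ‖v k i‖ ^ 2) := (Finset.mul_sum _ _ _).symm
    _ ≤ √(Fintype.card ι) * (4 * ∑ k, ‖∑ i, ε i • v k i‖) := by gcongr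
    _ = 4 * √(Fintype.card ι) * ∑ k, ‖∑ i, ε i • v k i‖ := by ring

end Khinchine

section MultilinearForm

universe u

theorem exists_weights_sum_sum_norm_le {κ : Type u} [Fintype κ] {m : ℕ}
    {α : Fin m → Type u} [∀ j, Fintype (α j)] (c : κ → (∀ j, α j) → ℂ) :
    ∃ w : ∀ j, α j → ℂ, (∀ j x, ‖w j x‖ ≤ 1) ∧
      ∑ k, ∑ i, ‖c k i‖ ≤
        (∏ j, 4 * √(Fintype.card (α j))) * ∑ k, ‖∑ i, c k i * ∏ j, w j (i j)‖ := by
  induction m generalizing κ with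
  | zero => exact ⟨fun _ _ => 0, by simp, by simp⟩
  | succ m ih =>
    obtain ⟨w, hw, hle⟩ := ih (κ := κ × α 0) fun k i => c k.1 (Fin.cons k.2 i)
    let form (k : κ) (x : α 0) : ℂ := ∑ i, c k (Fin.cons x i) * ∏ j, w j (i j)
    obtain ⟨ε, hε, hsigns⟩ := exists_signs_sum_sum_norm_le form
    refine ⟨Fin.cons (fun x => (ε x : ℂ)) w, Fin.forall_fin_succ.2 ⟨?_, fun j => ?_⟩, ?_⟩
    · simp [hε]
    · simpa using hw j
    have hform (k : κ) : ∑ i, c k i * ∏ j, Fin.cons (α := fun j => α j → ℂ)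
        (fun x => (ε x : ℂ)) w j (i j) = ∑ x, ε x • form k x := by
      rw [← (Fin.consEquiv α).sum_comp, Fintype.sum_prod_type]
      simp [form, Fin.consEquiv, Fin.prod_univ_succ, Finset.mul_sum, mul_left_comm]
    calc ∑ k, ∑ i, ‖c k i‖ = ∑ k : κ × α 0, ∑ i, ‖c k.1 (Fin.cons k.2 i)‖ := by
          rw [Fintype.sum_prod_type]
          refine Finset.sum_congr rfl fun k _ => ?_
          rw [← (Fin.consEquiv α).sum_comp, Fintype.sum_prod_type]
          rfl
      _ ≤ (∏ j : Fin m, 4 * √(Fintype.card (α j.succ))) * ∑ k, ∑ x, ‖form k x‖ := by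
          rwa [Fintype.sum_prod_type fun k : κ × α 0 => ‖_‖] at hle
      _ ≤ (∏ j : Fin m, 4 * √(Fintype.card (α j.succ))) *
            (4 * √(Fintype.card (α 0)) * ∑ k, ‖∑ x, ε x • form k x‖) := by
          gcongr
      _ = _ := by
          simp only [hform]
          rw [Fin.prod_univ_succ]
          ring

theorem exists_weights_sum_norm_le {m : ℕ} {α : Fin (m + 1) → Type*} [∀ j, Fintype (α j)]
    (k : Fin (m + 1)) (c : (∀ j, α j) → ℂ) :
    ∃ w : ∀ j, α j → ℂ, (∀ j x, ‖w j x‖ ≤ 1) ∧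
      ∑ i, ‖c i‖ ≤
        (∏ j, 4 * √(Fintype.card (α (k.succAbove j)))) * ‖∑ i, c i * ∏ j, w j (i j)‖ := by
  obtain ⟨w, hw, hle⟩ := exists_weights_sum_sum_norm_le fun (x : α k) i => c (k.insertNth x i)
  let form (x : α k) : ℂ := ∑ i, c (k.insertNth x i) * ∏ j, w j (i j)
  choose e he hform using fun x => Complex.exists_norm_eq_mul_self (form x)
  refine ⟨k.insertNth e w, (Fin.forall_iff_succAbove k).2 ⟨?_, fun j => ?_⟩, ?_⟩
  · exact fun x => by simp [he]
  · simpa using hw j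
  have hsum : ∑ i, c i * ∏ j, k.insertNth (α := fun j => α j → ℂ) e w j (i j) =
      ((∑ x, ‖form x‖ : ℝ) : ℂ) := by
    rw [← (Fin.insertNthEquiv α k).sum_comp, Fintype.sum_prod_type]
    push_cast
    refine Finset.sum_congr rfl fun x _ => ?_
    rw [hform x, Finset.mul_sum]
    simp [Fin.insertNthEquiv, Fin.prod_univ_succAbove _ k, mul_left_comm]
  have hnorm : ∑ i, ‖c i‖ = ∑ x, ∑ i, ‖c (k.insertNth x i)‖ := by
    rw [← (Fin.insertNthEquiv α k).sum_comp, Fintype.sum_prod_type]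
    rfl
  rwa [hnorm, hsum, Complex.norm_real, Real.norm_of_nonneg (by positivity)]

end MultilinearForm

section Mean
open MeasureTheory

/-- The mean value `lim (1 / 2T) ∫_{-T}^{T} g` of a function on the real line exists and is `m`. -/
def HasMean {E : Type*} [NormedAddCommGroup E] [NormedSpace ℝ E] (g : ℝ → E) (m : E) : Prop :=
  Tendsto (fun T : ℝ => ⨍ t in (-T)..T, g t) atTop (𝓝 m)

theorem intervalAverage_const {E : Type*} [NormedAddCommGroup E] [NormedSpace ℝ E]
    [CompleteSpace E] {T : ℝ} (hT : 0 < T) (c : E) : ⨍ _ in (-T)..T, c = c := by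
  rw [interval_average_eq, intervalIntegral.integral_const, smul_smul,
    inv_mul_cancel₀ (by linarith), one_smul]

theorem norm_intervalAverage_le {E : Type*} [NormedAddCommGroup E] [NormedSpace ℝ E] {g : ℝ → E}
    {G : ℝ → ℝ} (hG : Continuous G) (hg : ∀ t, ‖g t‖ ≤ G t) {T : ℝ} (hT : 0 < T) :
    ‖⨍ t in (-T)..T, g t‖ ≤ ⨍ t in (-T)..T, G t := by
  rw [interval_average_eq, interval_average_eq, norm_smul, Real.norm_of_nonneg (by simp [hT.le]),
    smul_eq_mul]
  gcongr
  · simp [hT.le]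
  · exact intervalIntegral.norm_integral_le_of_norm_le (by linarith)
      (Eventually.of_forall fun t _ => hg t) (hG.intervalIntegrable _ _)

namespace HasMean

theorem norm_le {E : Type*} [NormedAddCommGroup E] [NormedSpace ℝ E] {g : ℝ → E} {m : E}
    {G : ℝ → ℝ} {M : ℝ} (h : HasMean g m) (hM : HasMean G M) (hG : Continuous G)
    (hg : ∀ t, ‖g t‖ ≤ G t) : ‖m‖ ≤ M :=
  le_of_tendsto_of_tendsto h.norm hM <| (eventually_gt_atTop 0).mono fun _ hT =>
    norm_intervalAverage_le hG hg hT

theorem of_ofReal {g : ℝ → ℝ} {m : ℝ} (h : HasMean (fun t => (g t : ℂ)) m) : HasMean g m := by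
  refine (Complex.continuous_re.continuousAt.tendsto.comp h).congr fun T => ?_
  rw [Function.comp_apply, interval_average_eq, intervalIntegral.integral_ofReal,
    interval_average_eq, Complex.real_smul, ← Complex.ofReal_mul, Complex.ofReal_re, smul_eq_mul]

theorem const_mul {g : ℝ → ℂ} {m : ℂ} (h : HasMean g m) (c : ℂ) :
    HasMean (fun t => c * g t) (c * m) := by
  refine (Tendsto.const_mul c h).congr fun T => ?_
  simp only [interval_average_eq, intervalIntegral.integral_const_mul, mul_smul_comm]

theorem sum {ι : Type*} {s : Finset ι} {g : ι → ℝ → ℂ} {m : ι → ℂ}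
    (h : ∀ i ∈ s, HasMean (g i) (m i)) (hg : ∀ i ∈ s, Continuous (g i)) :
    HasMean (fun t => ∑ i ∈ s, g i t) (∑ i ∈ s, m i) := by
  refine (tendsto_finsetSum s h).congr fun T => ?_
  simp only [interval_average_eq, ← Finset.smul_sum]
  rw [intervalIntegral.integral_finsetSum fun i hi => (hg i hi).intervalIntegrable _ _]

theorem tsum {g : ℕ → ℝ → ℂ} {m : ℕ → ℂ} {u : ℕ → ℝ} (h : ∀ n, HasMean (g n) (m n))
    (hg : ∀ n, Continuous (g n)) (hu : Summable u) (hgu : ∀ n t, ‖g n t‖ ≤ u n) :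
    HasMean (fun t => ∑' n, g n t) (∑' n, m n) := by
  have hmean (T : ℝ) : ∑' n, ⨍ t in (-T)..T, g n t = ⨍ t in (-T)..T, ∑' n, g n t := by
    simp only [interval_average_eq]
    rw [tsum_const_smul'', (intervalIntegral.hasSum_integral_of_dominated_convergence
      (fun n _ => u n) (fun n => (hg n).aestronglyMeasurable)
      (fun n => .of_forall fun t _ => hgu n t) (.of_forall fun _ _ => hu) intervalIntegrable_const
      (.of_forall fun t _ => (Summable.of_norm_bounded hu (hgu · t)).hasSum)).tsum_eq]
  refine (tendsto_tsum_of_dominated_convergence hu h ?_).congr hmean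
  filter_upwards [eventually_gt_atTop 0] with T hT n
  exact (norm_intervalAverage_le continuous_const (hgu n) hT).trans_eq (intervalAverage_const hT _)

theorem of_norm_integral_sub_le {E : Type*} [NormedAddCommGroup E] [NormedSpace ℝ E]
    {g h : ℝ → E} {m : E} {K : ℝ} (hh : HasMean h m)
    (hK : ∀ T, 0 < T → ‖(∫ t in (-T)..T, g t) - ∫ t in (-T)..T, h t‖ ≤ K) : HasMean g m := by
  have hdiff : Tendsto (fun T : ℝ => (⨍ t in (-T)..T, g t) - ⨍ t in (-T)..T, h t) atTop (𝓝 0) := by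
    refine squeeze_zero_norm' (a := fun T => (2 * T)⁻¹ * K) ?_ ?_
    · filter_upwards [eventually_gt_atTop 0] with T hT
      rw [interval_average_eq, interval_average_eq, ← smul_sub, norm_smul, sub_neg_eq_add,
        ← two_mul, Real.norm_of_nonneg (by positivity)]
      exact mul_le_mul_of_nonneg_left (hK T hT) (by positivity)
    · have := (tendsto_inv_atTop_zero.comp (tendsto_id.const_mul_atTop two_pos)).mul_const K
      simpa [Function.comp_def] using this
  simpa [HasMean] using hdiff.add hh

end HasMean

theorem hasMean_const {E : Type*} [NormedAddCommGroup E] [NormedSpace ℝ E] [CompleteSpace E]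
    (c : E) : HasMean (fun _ => c) c :=
  tendsto_const_nhds.congr' <| (eventually_gt_atTop 0).mono fun _ hT =>
    (intervalAverage_const hT c).symm

theorem hasMean_cpow_mul_I {x : ℝ} (hx : 0 < x) :
    HasMean (fun t : ℝ => (x : ℂ) ^ (t * Complex.I)) (if x = 1 then 1 else 0) := by
  split_ifs with h
  · simpa [h] using hasMean_const (1 : ℂ)
  let c : ℂ := (Real.log x : ℂ) * Complex.I
  have hc : c ≠ 0 := by simp [c, Real.log_ne_zero_of_pos_of_ne_one hx h]
  have hexp (t : ℝ) : (x : ℂ) ^ (t * Complex.I) = Complex.exp (c * t) := by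
    rw [Complex.cpow_def_of_ne_zero (Complex.ofReal_ne_zero.2 hx.ne'), ← Complex.ofReal_log hx.le,
      mul_left_comm, mul_comm]
  have hnorm (t : ℝ) : ‖Complex.exp (c * t)‖ = 1 := by
    rw [← hexp, Complex.norm_cpow_eq_rpow_re_of_pos hx]
    simp
  refine HasMean.of_norm_integral_sub_le (K := 2 / ‖c‖) (hasMean_const 0) fun T _ => ?_
  simp only [hexp, intervalIntegral.integral_zero, sub_zero]
  rw [integral_exp_mul_complex hc, norm_div]
  gcongr
  refine (norm_sub_le _ _).trans_eq ?_
  rw [hnorm, hnorm]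
  norm_num

theorem norm_integral_sub_integral_vertical_le {g : ℂ → ℂ} {κ c B T : ℝ} (hκc : κ ≤ c)
    (hg : DifferentiableOn ℂ g {s | κ ≤ s.re})
    (hB : ∀ s : ℂ, κ ≤ s.re → s.re ≤ c → ‖g s‖ ≤ B) :
    ‖(∫ t in (-T)..T, g (κ + t * Complex.I)) - ∫ t in (-T)..T, g (c + t * Complex.I)‖ ≤
      2 * (B * (c - κ)) := by
  have hhor (y : ℝ) : ‖∫ u in κ..c, g (u + y * Complex.I)‖ ≤ B * (c - κ) := by
    rw [← abs_of_nonneg (sub_nonneg.2 hκc)]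
    refine intervalIntegral.norm_integral_le_of_norm_le_const fun u hu => ?_
    rw [Set.uIoc_of_le hκc] at hu
    exact hB _ (by simpa using hu.1.le) (by simpa using hu.2)
  have hrect := Complex.integral_boundary_rect_eq_zero_of_differentiableOn g
    (κ - T * Complex.I) (c + T * Complex.I) <| hg.mono fun s hs => by
      have hre : s.re ∈ Set.Icc κ c := by
        simpa [Set.uIcc_of_le hκc] using (Complex.mem_reProdIm.1 hs).1
      exact hre.1
  simp only [Complex.sub_re, Complex.ofReal_re, Complex.mul_re, Complex.I_re, mul_zero,
    Complex.ofReal_im, Complex.I_im, mul_one, sub_self, sub_zero, Complex.add_re, add_zero,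
    Complex.sub_im, Complex.mul_im, zero_sub, Complex.add_im, zero_add, smul_eq_mul] at hrect
  have hvert : Complex.I * ((∫ t in (-T)..T, g (κ + t * Complex.I)) -
        ∫ t in (-T)..T, g (c + t * Complex.I)) =
      (∫ u in κ..c, g (u + (-T : ℝ) * Complex.I)) - ∫ u in κ..c, g (u + T * Complex.I) := by
    linear_combination -hrect
  calc _ = ‖(∫ u in κ..c, g (u + (-T : ℝ) * Complex.I)) -
        ∫ u in κ..c, g (u + T * Complex.I)‖ := by
        rw [← hvert, norm_mul, Complex.norm_I, one_mul]
    _ ≤ B * (c - κ) + B * (c - κ) := norm_sub_le_of_le (hhor _) (hhor _)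
    _ = 2 * (B * (c - κ)) := (two_mul _).symm

theorem HasMean.of_vertical_shift {g : ℂ → ℂ} {κ c B : ℝ} {m : ℂ} (hκc : κ ≤ c)
    (hg : DifferentiableOn ℂ g {s | κ ≤ s.re}) (hB : ∀ s : ℂ, κ ≤ s.re → s.re ≤ c → ‖g s‖ ≤ B)
    (h : HasMean (fun t : ℝ => g (c + t * Complex.I)) m) :
    HasMean (fun t : ℝ => g (κ + t * Complex.I)) m :=
  h.of_norm_integral_sub_le fun _ _ => norm_integral_sub_integral_vertical_le hκc hg hB

end Mean

section DirichletSeries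
open MeasureTheory

variable {c : ℕ → ℂ} {B : ℝ}

theorem sum_Icc_zero_eq_sum_Icc_one (hc₀ : c 0 = 0) (N : ℕ) :
    ∑ n ∈ Finset.Icc 0 N, c n = ∑ n ∈ Finset.Icc 1 N, c n := by
  rw [← Finset.insert_Icc_add_one_left_eq_Icc N.zero_le, Finset.sum_insert (by simp), hc₀, zero_add,
    zero_add]

theorem differentiableAt_mellin_summatory (hc₀ : c 0 = 0)
    (hB : ∀ N : ℕ, ‖∑ n ∈ Finset.Icc 0 N, c n‖ ≤ B) {s : ℂ} (hs : s.re < 0) :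
    DifferentiableAt ℂ (mellin fun t : ℝ => ∑ n ∈ Finset.Icc 0 ⌊t⌋₊, c n) s := by
  refine mellin_differentiableAt_of_isBigO_rpow (a := 0) (b := s.re - 1) ?_ ?_ hs ?_ (by linarith)
  · have := locallyIntegrableOn_mul_sum_Icc c (m := 0) le_rfl
      (locallyIntegrableOn_const (1 : ℂ) (s := Set.Ici 0) (μ := volume))
    simpa only [one_mul] using this.mono_set Set.Ioi_subset_Ici_self
  · refine .of_bound B (Eventually.of_forall fun t => ?_)
    simpa using hB ⌊t⌋₊
  · refine EventuallyEq.trans_isBigO ?_ (Asymptotics.isBigO_zero _ _)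
    filter_upwards [Ioo_mem_nhdsGT one_pos] with t ht
    simp [Nat.floor_eq_zero.2 ht.2, hc₀]

theorem mul_mellin_summatory_neg (hc₀ : c 0 = 0) {w : ℂ} (hw : w ≠ 0) :
    w * mellin (fun t : ℝ => ∑ n ∈ Finset.Icc 0 ⌊t⌋₊, c n) (-w) =
      -∫ t in Set.Ioi (1 : ℝ), deriv (fun x : ℝ => (x : ℂ) ^ (-w)) t *
        ∑ n ∈ Finset.Icc 0 ⌊t⌋₊, c n := by
  have hsupport : ∀ t ∈ Set.Ioi (0 : ℝ) \ Set.Ici 1,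
      (t : ℂ) ^ (-w - 1) • ∑ n ∈ Finset.Icc 0 ⌊t⌋₊, c n = 0 := by
    rintro t ⟨-, ht⟩
    simp [Nat.floor_eq_zero.2 (Set.notMem_Ici.1 ht), hc₀]
  rw [mellin, setIntegral_eq_of_subset_of_forall_sdiff_eq_zero measurableSet_Ioi
    (Set.Ici_subset_Ioi.2 one_pos) hsupport, integral_Ici_eq_integral_Ioi,
    ← integral_const_mul, ← integral_neg]
  refine setIntegral_congr_fun measurableSet_Ioi fun t ht => ?_
  rw [Complex.deriv_ofReal_cpow_const (zero_lt_one.trans ht).ne' (neg_ne_zero.2 hw), smul_eq_mul]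
  ring

theorem tendsto_sum_cpow_mul_mellin_summatory (hc₀ : c 0 = 0)
    (hB : ∀ N : ℕ, ‖∑ n ∈ Finset.Icc 0 N, c n‖ ≤ B) {w : ℂ} (hw : 0 < w.re) :
    Tendsto (fun N : ℕ => ∑ n ∈ Finset.Icc 0 N, (n : ℂ) ^ (-w) * c n) atTop
      (𝓝 (w * mellin (fun t : ℝ => ∑ n ∈ Finset.Icc 0 ⌊t⌋₊, c n) (-w))) := by
  have hw₀ : w ≠ 0 := Complex.ne_zero_of_re_pos hw
  have hdiff : ∀ t ∈ Set.Ici (1 : ℝ), DifferentiableAt ℝ (fun x : ℝ => (x : ℂ) ^ (-w)) t :=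
    fun t ht => differentiableAt_id.ofReal_cpow_const (zero_lt_one.trans_le ht).ne'
      (neg_ne_zero.2 hw₀)
  have hint : LocallyIntegrableOn (deriv fun x : ℝ => (x : ℂ) ^ (-w)) (Set.Ici 1) :=
    ((integrableOn_Ici_iff_integrableOn_Ioi).2 <|
      integrableOn_Ioi_deriv_ofReal_cpow one_pos (by simpa using hw)).locallyIntegrableOn
  have hsum : (fun N : ℕ => ∑ n ∈ Finset.Icc 0 N, c n) =O[atTop] fun _ => (1 : ℝ) :=
    .of_bound B (Eventually.of_forall fun N => by simpa using hB N)
  have hlim : Tendsto (fun N : ℕ => ((N : ℝ) : ℂ) ^ (-w) * ∑ n ∈ Finset.Icc 0 N, c n)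
      atTop (𝓝 0) := by
    have hpow : (fun N : ℕ => ((N : ℝ) : ℂ) ^ (-w)) =O[atTop] fun N : ℕ => (N : ℝ) ^ (-w.re) :=
      (Complex.norm_ofReal_cpow_eventually_eq_atTop (-w)).isBigO.natCast_atTop.of_norm_left
    simpa using (hpow.mul hsum).trans_tendsto
      (by simpa using! (tendsto_rpow_neg_atTop hw).comp tendsto_natCast_atTop_atTop)
  have hdom : (fun t : ℝ => deriv (fun x : ℝ => (x : ℂ) ^ (-w)) t *
      ∑ n ∈ Finset.Icc 0 ⌊t⌋₊, c n) =O[atTop] fun t : ℝ => t ^ (-w.re - 1) := by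
    simpa using (isBigO_deriv_ofReal_cpow_const_atTop (-w)).mul
      (hsum.comp_tendsto tendsto_nat_floor_atTop)
  have hdom_int : IntegrableAtFilter (fun t : ℝ => t ^ (-w.re - 1)) atTop :=
    integrableAtFilter_rpow_atTop_iff.2 (by linarith)
  have key := tendsto_sum_mul_atTop_nhds_one_sub_integral₀ c hc₀ hdiff hint hlim hdom hdom_int
  rw [zero_sub, ← mul_mellin_summatory_neg hc₀ hw₀] at key
  simpa only [Complex.ofReal_natCast] using key

/-- The Dirichlet series `∑ a n * n ^ (-s)` converges to `f s` on the open half plane `σ < re s`,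
and `C` bounds `f` there, so that `f` and `C` are witnesses of
`DirichletWalsh.ConvergesBoundedly a σ`. -/
def HasBoundedSum (a : ℕ → ℂ) (σ C : ℝ) (f : ℂ → ℂ) : Prop :=
  ∀ s : ℂ, σ < s.re →
    Tendsto (fun N : ℕ => ∑ n ∈ Finset.Icc 1 N, a n * (n : ℂ) ^ (-s)) atTop (𝓝 (f s)) ∧
      ‖f s‖ ≤ C

namespace HasBoundedSum

variable {a : ℕ → ℂ} {σ C : ℝ} {f : ℂ → ℂ}

theorem shift (h : HasBoundedSum a σ C f) (s₀ : ℂ) :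
    HasBoundedSum (fun n => a n * (n : ℂ) ^ (-s₀)) (σ - s₀.re) C fun s => f (s + s₀) := by
  intro s hs
  obtain ⟨hlim, hC⟩ := h (s + s₀) (by rw [Complex.add_re]; linarith)
  refine ⟨hlim.congr fun N => Finset.sum_congr rfl fun n hn => ?_, hC⟩
  have hn₀ : (n : ℂ) ≠ 0 := Nat.cast_ne_zero.2 (Nat.one_le_iff_ne_zero.1 (Finset.mem_Icc.1 hn).1)
  rw [mul_assoc, ← Complex.cpow_add _ _ hn₀, neg_add_rev]

theorem differentiableOn_of_neg (h : HasBoundedSum a σ C f) (hσ : σ < 0) :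
    DifferentiableOn ℂ f {s | 0 < s.re} := by
  let c (n : ℕ) : ℂ := if n = 0 then 0 else a n
  have hsum (w : ℂ) (N : ℕ) : ∑ n ∈ Finset.Icc 0 N, (n : ℂ) ^ (-w) * c n =
      ∑ n ∈ Finset.Icc 1 N, a n * (n : ℂ) ^ (-w) := by
    rw [sum_Icc_zero_eq_sum_Icc_one (by simp [c])]
    refine Finset.sum_congr rfl fun n hn => ?_
    simp [c, Nat.one_le_iff_ne_zero.1 (Finset.mem_Icc.1 hn).1, mul_comm]
  obtain ⟨B, hB⟩ : ∃ B, ∀ N, ‖∑ n ∈ Finset.Icc 0 N, c n‖ ≤ B := by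
    obtain ⟨B, hB⟩ := (h 0 hσ).1.norm.bddAbove_range
    refine ⟨B, fun N => ?_⟩
    have : ‖∑ n ∈ Finset.Icc 1 N, a n * (n : ℂ) ^ (-0 : ℂ)‖ ≤ B := hB ⟨N, rfl⟩
    rw [← hsum] at this
    simpa using this
  refine DifferentiableOn.congr (f := fun s => s * mellin
    (fun t : ℝ => ∑ n ∈ Finset.Icc 0 ⌊t⌋₊, c n) (-s)) ?_ fun s hs => ?_
  · intro s hs
    have := differentiableAt_mellin_summatory (if_pos rfl) hB (s := -s) (by simpa using hs)
    exact (differentiableAt_id.mul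
      (this.comp s differentiableAt_id.neg)).differentiableWithinAt
  · refine tendsto_nhds_unique (h s (hσ.trans hs)).1 ?_
    simpa only [hsum] using
      tendsto_sum_cpow_mul_mellin_summatory (if_pos rfl) hB hs

theorem differentiableOn (h : HasBoundedSum a σ C f) : DifferentiableOn ℂ f {s | σ < s.re} := by
  intro s hs
  obtain ⟨x, hσx, hxs⟩ := exists_between (Set.mem_ofPred.1 hs)
  have := (h.shift x).differentiableOn_of_neg (by simpa using hσx)
  have hs' : 0 < (s - x).re := by simpa using hxs
  have hd := (this.differentiableAt ((isOpen_lt continuous_const Complex.continuous_re).mem_nhds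
    hs')).comp s (differentiableAt_id.sub_const (x : ℂ))
  simpa [Function.comp_def] using hd.differentiableWithinAt

theorem lseriesSummable (h : HasBoundedSum a σ C f) (hσ : σ < 0) {s : ℂ} (hs : 1 < s.re) :
    LSeriesSummable a s := by
  have hlim : Tendsto (fun N : ℕ => ∑ n ∈ Finset.Icc 1 N, a n) atTop (𝓝 (f 0)) := by
    simpa using (h 0 hσ).1
  have hzero : Tendsto a atTop (𝓝 0) := by
    rw [← tendsto_add_atTop_iff_nat 1, ← sub_self (f 0)]
    refine ((hlim.comp (tendsto_add_atTop_nat 1)).sub hlim).congr fun N => ?_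
    simp [Finset.sum_Icc_succ_top]
  exact LSeriesSummable_of_isBigO_rpow hs (by simpa using hzero.isBigO_one ℝ)

theorem eq_lseries (h : HasBoundedSum a σ C f) {s : ℂ} (hσ : σ < s.re) (hs : LSeriesSummable a s) :
    f s = LSeries a s := by
  have hlim := (tendsto_add_atTop_iff_nat 1).2 hs.hasSum.tendsto_sum_nat
  refine tendsto_nhds_unique (h s hσ).1 (hlim.congr fun N => ?_)
  rw [Nat.range_succ_eq_Icc_zero, sum_Icc_zero_eq_sum_Icc_one (LSeries.term_zero a s)]
  refine Finset.sum_congr rfl fun n hn => ?_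
  rw [LSeries.term_of_ne_zero (Nat.one_le_iff_ne_zero.1 (Finset.mem_Icc.1 hn).1),
    Complex.cpow_neg, div_eq_mul_inv]

end HasBoundedSum

end DirichletSeries

section DirichletMean

theorem lseries_term_mul_cpow (a : ℕ → ℂ) {x : ℝ} (hx : 0 < x) {s : ℂ} (hs : s ≠ 0) (n : ℕ) :
    LSeries.term a s n * (x : ℂ) ^ s = a n * ((x / n : ℝ) : ℂ) ^ s := by
  rcases eq_or_ne n 0 with rfl | hn
  · simp [hs]
  rw [LSeries.term_of_ne_zero hn, Complex.ofReal_div,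
    Complex.div_cpow_ofReal_nonneg hx.le n.cast_nonneg, Complex.ofReal_natCast, div_mul_eq_mul_div,
    mul_div_assoc]

theorem tsum_mul_ite_div_eq_one (a : ℕ → ℂ) {x : ℝ} (hx : x ≠ 0) :
    ∑' n : ℕ, a n * ((x / n : ℝ) : ℂ) ^ 2 * (if x / n = 1 then 1 else 0) =
      Function.extend (Nat.cast : ℕ → ℝ) a 0 x := by
  have hdiv (n : ℕ) (h : x / n = 1) : (n : ℝ) = x := (eq_of_div_eq_one h).symm
  by_cases hx' : ∃ n : ℕ, (n : ℝ) = x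
  · obtain ⟨n, rfl⟩ := hx'
    rw [Nat.cast_injective.extend_apply, tsum_eq_single n fun k hk => ?_]
    · simp [div_self hx]
    · rw [if_neg fun h => hk (Nat.cast_injective (hdiv k h)), mul_zero]
  · rw [Function.extend_apply' _ _ _ hx', Pi.zero_apply]
    refine (tsum_congr fun n => ?_).trans tsum_zero
    rw [if_neg fun h => hx' ⟨n, hdiv n h⟩, mul_zero]

namespace HasBoundedSum

variable {a : ℕ → ℂ} {σ C : ℝ} {f : ℂ → ℂ}

theorem mul_cpow_eq_tsum (h : HasBoundedSum a σ C f) (hσ : σ < 0) {x : ℝ} (hx : 0 < x) {s : ℂ}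
    (hs : 1 < s.re) :
    f s * (x : ℂ) ^ s = ∑' n : ℕ, a n * ((x / n : ℝ) : ℂ) ^ s := by
  have hs₀ : s ≠ 0 := Complex.ne_zero_of_re_pos (zero_lt_one.trans hs)
  rw [h.eq_lseries (by linarith) (h.lseriesSummable hσ hs), LSeries, ← tsum_mul_right]
  exact tsum_congr fun n => lseries_term_mul_cpow a hx hs₀ n

theorem hasMean_mul_cpow_two_add (h : HasBoundedSum a σ C f) (hσ : σ < 0) {x : ℝ} (hx : 0 < x) :
    HasMean (fun t : ℝ => f ((2 : ℝ) + t * Complex.I) * (x : ℂ) ^ ((2 : ℝ) + t * Complex.I))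
      (Function.extend (Nat.cast : ℕ → ℝ) a 0 x) := by
  have hre (t : ℝ) : ((2 : ℝ) + t * Complex.I : ℂ).re = 2 := by simp
  have hne (t : ℝ) : ((2 : ℝ) + t * Complex.I : ℂ) ≠ 0 :=
    Complex.ne_zero_of_re_pos ((hre t).symm ▸ two_pos)
  have hnorm (n : ℕ) (t : ℝ) : ‖a n * ((x / n : ℝ) : ℂ) ^ ((2 : ℝ) + t * Complex.I)‖ =
      ‖LSeries.term a 2 n * (x : ℂ) ^ (2 : ℂ)‖ := by
    rw [lseries_term_mul_cpow a hx two_ne_zero, norm_mul, norm_mul,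
      Complex.norm_cpow_eq_rpow_re_of_nonneg (by positivity) ((hre t).symm ▸ two_ne_zero),
      Complex.norm_cpow_eq_rpow_re_of_nonneg (by positivity) (by simp), hre, Complex.re_ofNat]
  have hmean (n : ℕ) : HasMean (fun t : ℝ => a n * ((x / n : ℝ) : ℂ) ^ ((2 : ℝ) + t * Complex.I))
      (a n * ((x / n : ℝ) : ℂ) ^ 2 * (if x / n = 1 then 1 else 0)) := by
    rcases eq_or_ne n 0 with rfl | hn
    · simpa only [Nat.cast_zero, div_zero, Complex.ofReal_zero, Complex.zero_cpow (hne _),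
        zero_pow two_ne_zero, mul_zero, zero_mul] using hasMean_const (0 : ℂ)
    have hxn : 0 < x / n := div_pos hx (Nat.cast_pos.2 (Nat.pos_of_ne_zero hn))
    convert! (hasMean_cpow_mul_I hxn).const_mul (a n * ((x / n : ℝ) : ℂ) ^ 2) using 2 with t
    rw [Complex.cpow_add _ _ (Complex.ofReal_ne_zero.2 hxn.ne'), ← mul_assoc, Complex.ofReal_ofNat,
      Complex.cpow_ofNat]
  rw [← tsum_mul_ite_div_eq_one a hx.ne']
  simp only [h.mul_cpow_eq_tsum hσ hx ((hre _).symm ▸ one_lt_two)]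
  have hcont (n : ℕ) :
      Continuous fun t : ℝ => a n * ((x / n : ℝ) : ℂ) ^ ((2 : ℝ) + t * Complex.I) :=
    continuous_const.mul (Continuous.const_cpow (by fun_prop) (.inr hne))
  have hsum : LSeriesSummable a 2 := h.lseriesSummable hσ (by simp)
  exact .tsum hmean hcont (hsum.mul_right _).norm fun n t => (hnorm n t).le

-- The mean is the same on every vertical line, and on `re s = 2` the series converges absolutely.
theorem hasMean_mul_cpow (h : HasBoundedSum a σ C f) (hσ : σ < 0) {x : ℝ} (hx : 0 < x) :
    HasMean (fun t : ℝ => f (t * Complex.I) * (x : ℂ) ^ (t * Complex.I))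
      (Function.extend (Nat.cast : ℕ → ℝ) a 0 x) := by
  have hx₀ : (x : ℂ) ≠ 0 := Complex.ofReal_ne_zero.2 hx.ne'
  have hdiff : DifferentiableOn ℂ (fun s => f s * (x : ℂ) ^ s) {s | (0 : ℝ) ≤ s.re} :=
    (h.differentiableOn.mono fun s hs => hσ.trans_le hs).mul
      (differentiable_id.const_cpow (.inl hx₀)).differentiableOn
  have hbound (s : ℂ) (hs₀ : 0 ≤ s.re) (hs₂ : s.re ≤ 2) :
      ‖f s * (x : ℂ) ^ s‖ ≤ C * max 1 (x ^ (2 : ℝ)) := by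
    rw [norm_mul, Complex.norm_cpow_eq_rpow_re_of_pos hx]
    gcongr
    · exact (norm_nonneg _).trans (h s (hσ.trans_le hs₀)).2
    · exact (h s (hσ.trans_le hs₀)).2
    · rcases le_total x 1 with hx₁ | hx₁
      · exact le_max_of_le_left (Real.rpow_le_one hx.le hx₁ hs₀)
      · exact le_max_of_le_right (Real.rpow_le_rpow_of_exponent_le hx₁ hs₂)
  simpa using HasMean.of_vertical_shift two_pos.le hdiff hbound (h.hasMean_mul_cpow_two_add hσ hx)

end HasBoundedSum

end DirichletMean

section RieszProduct
open ComplexConjugate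

variable {Q : Type*} {p : Q → ℕ} {z : Q → ℂ}

theorem prod_natCast_cpow (p : Q → ℕ) (A : Finset Q) (s : ℂ) :
    ∏ q ∈ A, (p q : ℂ) ^ s = ((∏ q ∈ A, p q : ℕ) : ℂ) ^ s := by
  classical
  induction A using Finset.induction_on with
  | empty => simp
  | insert q A hq ih =>
    rw [Finset.prod_insert hq, Finset.prod_insert hq, ih, Nat.cast_mul,
      Complex.natCast_mul_natCast_cpow]

theorem natCast_cpow_mul_I_mul_conj (m n : ℕ) (t : ℝ) :
    (m : ℂ) ^ (t * Complex.I) * conj ((n : ℂ) ^ (t * Complex.I)) =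
      ((m / n : ℝ) : ℂ) ^ (t * Complex.I) := by
  have hconj : conj ((n : ℂ) ^ (t * Complex.I)) = ((n : ℂ) ^ (t * Complex.I))⁻¹ := by
    rw [← Complex.cpow_neg]
    have harg : (n : ℂ).arg ≠ Real.pi := Complex.natCast_arg ▸ Real.pi_ne_zero.symm
    simpa using (Complex.cpow_conj n (t * Complex.I) harg).symm
  rw [hconj, Complex.ofReal_div, Complex.div_cpow_ofReal_nonneg m.cast_nonneg n.cast_nonneg,
    div_eq_mul_inv, Complex.ofReal_natCast, Complex.ofReal_natCast]

theorem prod_primes_dvd_iff_subset (hp : Function.Injective p) (hprime : ∀ q, (p q).Prime)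
    {A B : Finset Q} : ∏ q ∈ B, p q ∣ ∏ q ∈ A, p q ↔ B ⊆ A := by
  refine ⟨fun h q hq => ?_, fun h => Finset.prod_dvd_prod_of_subset _ _ _ h⟩
  obtain ⟨r, hr, hqr⟩ :=
    (hprime q).prime.exists_mem_finset_dvd ((Finset.dvd_prod_of_mem p hq).trans h)
  rwa [hp ((Nat.prime_dvd_prime_iff_eq (hprime q) (hprime r)).1 hqr)]

theorem extend_natCast_prod_div [DecidableEq Q] (hp : Function.Injective p)
    (hprime : ∀ q, (p q).Prime) (a : ℕ → ℂ) {A B : Finset Q} (hAB : Disjoint A B) :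
    Function.extend (Nat.cast : ℕ → ℝ) a 0 ((∏ q ∈ A, p q : ℕ) / (∏ q ∈ B, p q : ℕ)) =
      if B = ∅ then a (∏ q ∈ A, p q) else 0 := by
  split_ifs with hB
  · rw [hB, Finset.prod_empty, Nat.cast_one, div_one, Nat.cast_injective.extend_apply]
  · refine Function.extend_apply' _ _ _ fun ⟨n, hn⟩ => hB ?_
    have hB₀ : ((∏ q ∈ B, p q : ℕ) : ℝ) ≠ 0 :=
      Nat.cast_ne_zero.2 (Finset.prod_ne_zero_iff.2 fun q _ => (hprime q).ne_zero)
    have hdvd : ∏ q ∈ B, p q ∣ ∏ q ∈ A, p q :=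
      Dvd.intro_left n (by exact_mod_cast (eq_div_iff hB₀).1 hn)
    exact hAB.eq_bot_of_ge ((prod_primes_dvd_iff_subset hp hprime).1 hdvd)

variable [Fintype Q]

/-- The Riesz product `∏ q, (1 + re (z q * p q ^ (t * I)))`, a trigonometric polynomial in `t` that
is nonnegative if `‖z q‖ ≤ 1` for all `q`. -/
noncomputable def rieszProduct (p : Q → ℕ) (z : Q → ℂ) (t : ℝ) : ℝ :=
  ∏ q, (1 + (z q * (p q : ℂ) ^ (t * Complex.I)).re)

theorem rieszProduct_nonneg (hz : ∀ q, ‖z q‖ ≤ 1) (hp : ∀ q, p q ≠ 0) (t : ℝ) :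
    0 ≤ rieszProduct p z t := by
  refine Finset.prod_nonneg fun q _ => ?_
  have hnorm : ‖z q * (p q : ℂ) ^ (t * Complex.I)‖ ≤ 1 := by
    simpa [Complex.norm_natCast_cpow_of_pos (Nat.pos_of_ne_zero (hp q))] using hz q
  linarith [neg_le_of_abs_le ((Complex.abs_re_le_norm _).trans hnorm)]

theorem continuous_rieszProduct (hp : ∀ q, p q ≠ 0) : Continuous (rieszProduct p z) := by
  refine continuous_finsetProd _ fun q _ => continuous_const.add <| Complex.continuous_re.comp <|
    continuous_const.mul <| Continuous.const_cpow (by fun_prop) (.inl (Nat.cast_ne_zero.2 (hp q)))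

theorem ofReal_rieszProduct [DecidableEq Q] (p : Q → ℕ) (z : Q → ℂ) (t : ℝ) :
    (rieszProduct p z t : ℂ) = ∑ A : Finset Q, ∑ B ∈ Aᶜ.powerset,
      (∏ q ∈ A, z q / 2) * (∏ q ∈ B, conj (z q) / 2) *
        (((∏ q ∈ A, p q : ℕ) / (∏ q ∈ B, p q : ℕ) : ℝ) : ℂ) ^ (t * Complex.I) := by
  have hfactor (q : Q) : ((1 + (z q * (p q : ℂ) ^ (t * Complex.I)).re : ℝ) : ℂ) =
      z q / 2 * (p q : ℂ) ^ (t * Complex.I) +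
        (1 + conj (z q) / 2 * conj ((p q : ℂ) ^ (t * Complex.I))) := by
    rw [Complex.ofReal_add, Complex.ofReal_one, Complex.re_eq_add_conj, map_mul]
    ring
  rw [rieszProduct, Complex.ofReal_prod]
  simp only [hfactor, Fintype.prod_add, Finset.prod_one_add, Finset.mul_sum]
  refine Finset.sum_congr rfl fun A _ => Finset.sum_congr rfl fun B _ => ?_
  rw [← natCast_cpow_mul_I_mul_conj, ← prod_natCast_cpow, ← prod_natCast_cpow, map_prod,
    Finset.prod_mul_distrib, Finset.prod_mul_distrib]
  ring

namespace HasBoundedSum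

variable {a : ℕ → ℂ} {σ C : ℝ} {f : ℂ → ℂ}

theorem continuous_mul_I (h : HasBoundedSum a σ C f) (hσ : σ < 0) :
    Continuous fun t : ℝ => f (t * Complex.I) :=
  h.differentiableOn.continuousOn.comp_continuous (by fun_prop) fun t => by simpa using hσ

theorem hasMean_mul_rieszProduct (h : HasBoundedSum a σ C f) (hσ : σ < 0)
    (hp : Function.Injective p) (hprime : ∀ q, (p q).Prime) (z : Q → ℂ) :
    HasMean (fun t : ℝ => f (t * Complex.I) * rieszProduct p z t)
      (∑ A : Finset Q, (∏ q ∈ A, z q / 2) * a (∏ q ∈ A, p q)) := by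
  classical
  have hpos (A : Finset Q) : (0 : ℝ) < (∏ q ∈ A, p q : ℕ) :=
    Nat.cast_pos.2 (Finset.prod_pos fun q _ => (hprime q).pos)
  have hcont (x : ℝ) (hx : 0 < x) :
      Continuous fun t : ℝ => f (t * Complex.I) * (x : ℂ) ^ (t * Complex.I) :=
    (h.continuous_mul_I hσ).mul <|
      Continuous.const_cpow (by fun_prop) (.inl (Complex.ofReal_ne_zero.2 hx.ne'))
  have hdiagonal (A : Finset Q) : ∑ B ∈ Aᶜ.powerset, (∏ q ∈ A, z q / 2) *
        (∏ q ∈ B, conj (z q) / 2) * Function.extend (Nat.cast : ℕ → ℝ) a 0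
          ((∏ q ∈ A, p q : ℕ) / (∏ q ∈ B, p q : ℕ)) =
      (∏ q ∈ A, z q / 2) * a (∏ q ∈ A, p q) := by
    rw [Finset.sum_eq_single_of_mem ∅ (Finset.empty_mem_powerset _) fun B hB hB₀ => ?_]
    · rw [extend_natCast_prod_div hp hprime a (Finset.disjoint_empty_right A)]
      simp
    · rw [extend_natCast_prod_div hp hprime a
        (disjoint_compl_right.mono_right (Finset.mem_powerset.1 hB)), if_neg hB₀, mul_zero]
  simp only [ofReal_rieszProduct, Finset.mul_sum, mul_left_comm (f _), ← hdiagonal]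
  exact .sum (fun A _ => .sum
      (fun B _ => (h.hasMean_mul_cpow hσ (div_pos (hpos A) (hpos B))).const_mul _)
      fun B _ => (hcont _ (div_pos (hpos A) (hpos B))).const_mul _)
    fun A _ => continuous_finsetSum _ fun B _ => (hcont _ (div_pos (hpos A) (hpos B))).const_mul _

end HasBoundedSum

theorem hasBoundedSum_single_one {σ : ℝ} :
    HasBoundedSum (Pi.single 1 1) σ 1 fun _ => 1 := by
  refine fun s _ => ⟨tendsto_const_nhds.congr' ?_, norm_one.le⟩
  filter_upwards [eventually_ge_atTop 1] with N hN
  rw [Finset.sum_eq_single_of_mem 1 (Finset.mem_Icc.2 ⟨le_rfl, hN⟩)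
    fun n _ hn => by rw [Pi.single_eq_of_ne hn, zero_mul]]
  simp

theorem hasMean_rieszProduct (hp : Function.Injective p) (hprime : ∀ q, (p q).Prime) (z : Q → ℂ) :
    HasMean (fun t => (rieszProduct p z t : ℂ)) 1 := by
  have hmean := hasBoundedSum_single_one.hasMean_mul_rieszProduct neg_one_lt_zero hp hprime z
  rw [Finset.sum_eq_single_of_mem ∅ (Finset.mem_univ _) fun A _ hA => ?_] at hmean
  · simpa using hmean
  · have hone : ∏ q ∈ A, p q ≠ 1 := fun h =>
      hA <| Finset.subset_empty.1 <| (prod_primes_dvd_iff_subset hp hprime).1 <| by simp [h]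
    rw [Pi.single_eq_of_ne hone, mul_zero]

namespace HasBoundedSum

variable {a : ℕ → ℂ} {σ C : ℝ} {f : ℂ → ℂ}

theorem norm_sum_prod_mul_le (h : HasBoundedSum a σ C f) (hσ : σ < 0)
    (hp : Function.Injective p) (hprime : ∀ q, (p q).Prime) (hz : ∀ q, ‖z q‖ ≤ 1) :
    ‖∑ A : Finset Q, (∏ q ∈ A, z q / 2) * a (∏ q ∈ A, p q)‖ ≤ C := by
  have hp₀ (q : Q) : p q ≠ 0 := (hprime q).ne_zero
  have hmean : HasMean (fun t => C * rieszProduct p z t) C := by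
    refine HasMean.of_ofReal ?_
    simpa using (hasMean_rieszProduct hp hprime z).const_mul C
  refine (h.hasMean_mul_rieszProduct hσ hp hprime z).norm_le hmean
    ((continuous_rieszProduct hp₀).const_mul C) fun t => ?_
  rw [norm_mul, Complex.norm_real, Real.norm_of_nonneg (rieszProduct_nonneg hz hp₀ t)]
  exact mul_le_mul_of_nonneg_right (h _ (by simpa using hσ)).2 (rieszProduct_nonneg hz hp₀ t)

theorem norm_sum_prod_mul_le_of_norm_le_rpow {δ : ℝ} (h : HasBoundedSum a σ C f) (hσ : σ + δ < 0)
    (hp : Function.Injective p) (hprime : ∀ q, (p q).Prime) (hz : ∀ q, ‖z q‖ ≤ (p q : ℝ) ^ δ) :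
    ‖∑ A : Finset Q, (∏ q ∈ A, z q / 2) * a (∏ q ∈ A, p q)‖ ≤ C := by
  have hδ (q : Q) : (p q : ℂ) ^ (δ : ℂ) ≠ 0 := by
    simp [Complex.cpow_eq_zero_iff, (hprime q).ne_zero]
  have hshift := h.shift (-δ)
  rw [Complex.neg_re, Complex.ofReal_re, sub_neg_eq_add, neg_neg] at hshift
  refine (hshift.norm_sum_prod_mul_le hσ hp hprime (z := fun q => z q / (p q : ℂ) ^ (δ : ℂ))
    fun q => ?_).trans_eq' ?_
  · rw [norm_div, Complex.norm_natCast_cpow_of_pos (hprime q).pos, Complex.ofReal_re]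
    exact div_le_one_of_le₀ (hz q) (by positivity)
  · refine congrArg _ (Finset.sum_congr rfl fun A _ => ?_)
    rw [mul_comm (a _), ← mul_assoc, ← prod_natCast_cpow, ← Finset.prod_mul_distrib]
    refine congrArg₂ _ (Finset.prod_congr rfl fun q _ => ?_) rfl
    rw [div_right_comm, div_mul_cancel₀ _ (hδ q)]

end HasBoundedSum

end RieszProduct

section Transversal

variable {ι : Type*} [Fintype ι] {α : ι → Type*}

/-- The graph of a choice function `i`, the set of points that `i` picks from the disjoint union of
the sets `α j`: one point from each. -/
def transversal (i : ∀ j, α j) : Finset (Σ j, α j) :=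
  Finset.univ.sigma fun j => {i j}

theorem mem_transversal {i : ∀ j, α j} {q : Σ j, α j} : q ∈ transversal i ↔ q.2 = i q.1 := by
  simp [transversal]

theorem transversal_injective : Function.Injective (transversal : (∀ j, α j) → Finset (Σ j, α j)) :=
  fun _ _ h => funext fun j => mem_transversal.1 (h ▸ mem_transversal (q := ⟨j, _⟩) |>.2 rfl)

theorem prod_transversal {R : Type*} [CommMonoid R] (g : (Σ j, α j) → R) (i : ∀ j, α j) :
    ∏ q ∈ transversal i, g q = ∏ j, g ⟨j, i j⟩ := by
  simp [transversal, Finset.prod_sigma]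

theorem HasBoundedSum.pow_mul_sum_norm_le {a : ℕ → ℂ} {σ C : ℝ} {f : ℂ → ℂ}
    (h : HasBoundedSum a σ C f) {δ : ℝ} (hδ : 0 ≤ δ) (hσ : σ + δ < 0) {m : ℕ}
    {α : Fin (m + 1) → Type*} [∀ j, Fintype (α j)] {p : (Σ j, α j) → ℕ}
    (hp : Function.Injective p) (hprime : ∀ q, (p q).Prime) {N : ℕ} (hN : ∀ q, N ≤ p q)
    (ha : ∀ A, A ∉ Set.range transversal → a (∏ q ∈ A, p q) = 0) (k : Fin (m + 1)) :
    ((N : ℝ) ^ δ / 2) ^ (m + 1) * ∑ i : ∀ j, α j, ‖a (∏ j, p ⟨j, i j⟩)‖ ≤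
      (∏ j, 4 * √(Fintype.card (α (k.succAbove j)))) * C := by
  obtain ⟨w, hw, hle⟩ := exists_weights_sum_norm_le k fun i : ∀ j, α j => a (∏ j, p ⟨j, i j⟩)
  let z (q : Σ j, α j) : ℂ := ((N : ℝ) ^ δ : ℝ) * w q.1 q.2
  have hz (q : Σ j, α j) : ‖z q‖ ≤ (p q : ℝ) ^ δ := by
    rw [norm_mul, Complex.norm_real, Real.norm_of_nonneg (by positivity)]
    calc (N : ℝ) ^ δ * ‖w q.1 q.2‖ ≤ (N : ℝ) ^ δ := mul_le_of_le_one_right (by positivity) (hw _ _)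
      _ ≤ (p q : ℝ) ^ δ := by gcongr; exact hN q
  have hsum : ∑ A : Finset (Σ j, α j), (∏ q ∈ A, z q / 2) * a (∏ q ∈ A, p q) =
      (((N : ℝ) ^ δ / 2) ^ (m + 1) : ℝ) *
        ∑ i : ∀ j, α j, a (∏ j, p ⟨j, i j⟩) * ∏ j, w j (i j) := by
    rw [Finset.mul_sum, ← Fintype.sum_of_injective transversal transversal_injective _ _
      (fun A hA => by rw [ha A hA, mul_zero]) fun i => rfl]
    refine Finset.sum_congr rfl fun i _ => ?_
    rw [prod_transversal, prod_transversal]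
    simp only [z, mul_div_right_comm, Finset.prod_mul_distrib, Finset.prod_const,
      Finset.card_univ, Fintype.card_fin]
    push_cast
    ring
  have hbound := h.norm_sum_prod_mul_le_of_norm_le_rpow hσ hp hprime hz
  rw [hsum, norm_mul, Complex.norm_real, Real.norm_of_nonneg (by positivity)] at hbound
  calc _ ≤ ((N : ℝ) ^ δ / 2) ^ (m + 1) * ((∏ j, 4 * √(Fintype.card (α (k.succAbove j)))) *
        ‖∑ i : ∀ j, α j, a (∏ j, p ⟨j, i j⟩) * ∏ j, w j (i j)‖) := by gcongr
    _ = (∏ j, 4 * √(Fintype.card (α (k.succAbove j)))) * (((N : ℝ) ^ δ / 2) ^ (m + 1) *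
        ‖∑ i : ∀ j, α j, a (∏ j, p ⟨j, i j⟩) * ∏ j, w j (i j)‖) := mul_left_comm _ _ _
    _ ≤ _ := by gcongr

end Transversal

namespace DirichletWalsh

variable {M L : ℕ} {ρ : Fin M → ℝ}

/-- The primes available at level `L`, indexed by a position `j` and a possible entry of a
multi-index there, so that the integer of a multi-index is the product over its `transversal`. -/
noncomputable def levelPrime (ρ : Fin M → ℝ) (L : ℕ) (q : (j : Fin M) × Fin (size ρ L j)) : ℕ :=
  kthPrime ((M + (q.1 : ℕ)) * 2 ^ L + (q.2 : ℕ))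

theorem levelPrime_prime (q : (j : Fin M) × Fin (size ρ L j)) : (levelPrime ρ L q).Prime :=
  kthPrime_prime _

theorem two_pow_le_mul_two_pow_add (j : Fin M) (x : ℕ) : 2 ^ L ≤ (M + (j : ℕ)) * 2 ^ L + x :=
  (Nat.le_mul_of_pos_left _ (by have := j.pos; omega)).trans (Nat.le_add_right _ _)

theorem levelPrime_eq_levelPrime {L' : ℕ} {q : (j : Fin M) × Fin (size ρ L j)}
    {q' : (j : Fin M) × Fin (size ρ L' j)} (h : levelPrime ρ L q = levelPrime ρ L' q') :
    (M + (q.1 : ℕ)) * 2 ^ L + (q.2 : ℕ) = (M + (q'.1 : ℕ)) * 2 ^ L' + (q'.2 : ℕ) :=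
  kthPrime_inj (Nat.one_le_two_pow.trans (two_pow_le_mul_two_pow_add _ _))
    (Nat.one_le_two_pow.trans (two_pow_le_mul_two_pow_add _ _)) h

theorem two_pow_le_levelPrime (q : (j : Fin M) × Fin (size ρ L j)) : 2 ^ L ≤ levelPrime ρ L q := by
  have hindex := two_pow_le_mul_two_pow_add (L := L) q.1 q.2
  have hnth := Nat.add_two_le_nth_prime ((M + (q.1 : ℕ)) * 2 ^ L + (q.2 : ℕ) - 1)
  rw [levelPrime, kthPrime]
  omega

theorem levelPrime_injective (hρ : ∀ j, ρ j ≤ 1) : Function.Injective (levelPrime ρ L) := by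
  rintro ⟨j, x⟩ ⟨j', x'⟩ h
  have hindex : (x : ℕ) + 2 ^ L * (M + j) = x' + 2 ^ L * (M + j') := by
    simpa only [mul_comm, add_comm] using levelPrime_eq_levelPrime h
  have hpos : 0 < 2 ^ L := by positivity
  obtain ⟨hdiv, hmod⟩ := (Nat.div_mod_unique hpos).2 ⟨hindex, x.2.trans_le (size_le hρ L j)⟩
  obtain ⟨hdiv', hmod'⟩ :=
    (Nat.div_mod_unique (d := M + j') hpos).2 ⟨rfl, x'.2.trans_le (size_le hρ L j')⟩
  obtain rfl : j = j' := Fin.ext (Nat.add_left_cancel (hdiv.symm.trans hdiv'))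
  rw [Fin.ext (hmod.symm.trans hmod')]

theorem primeProduct_eq_prod_transversal (i : MultiIndex ρ L) :
    primeProduct ρ L i = ∏ q ∈ transversal i, levelPrime ρ L q :=
  (prod_transversal (levelPrime ρ L) i).symm

theorem coeff_prod_levelPrime_eq_zero (hM : 1 ≤ M) (hρ : ∀ j, ρ j ≤ 1) (X : ℝ) (β : ℕ → ℂ)
    {A : Finset ((j : Fin M) × Fin (size ρ L j))} (hA : A ∉ Set.range transversal) :
    coeff ρ X β (∏ q ∈ A, levelPrime ρ L q) = 0 := by
  refine coeff_eq_zero ρ X β fun L' _ i h => hA ?_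
  have hdvd : levelPrime ρ L' ⟨⟨0, hM⟩, i _⟩ ∣ ∏ q ∈ A, levelPrime ρ L q :=
    h ▸ Finset.dvd_prod_of_mem (fun j => levelPrime ρ L' ⟨j, i j⟩) (Finset.mem_univ _)
  obtain ⟨q, -, hq⟩ := (levelPrime_prime _).prime.exists_mem_finset_dvd hdvd
  have hindex := levelPrime_eq_levelPrime
    ((Nat.prime_dvd_prime_iff_eq (levelPrime_prime _) (levelPrime_prime _)).1 hq)
  obtain rfl : L = L' := le_antisymm
    (level_le hM ((i _).2.trans_le (size_le hρ L' _)) hindex)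
    (level_le q.1.2 (q.2.2.trans_le (size_le hρ L _)) hindex.symm)
  rw [primeProduct_eq_prod_transversal] at h
  have hsubset {B B' : Finset ((j : Fin M) × Fin (size ρ L j))} :=
    prod_primes_dvd_iff_subset (levelPrime_injective hρ) levelPrime_prime (A := B) (B := B')
  exact ⟨i, (hsubset.1 h.dvd).antisymm (hsubset.1 h.symm.dvd)⟩

theorem norm_walshPhase (i : MultiIndex ρ L) : ‖walshPhase ρ L i‖ = 1 := by
  have hroot (r : ℕ) : ‖rootOfUnity r‖ = 1 := by
    have hexp : rootOfUnity r = Complex.exp ((2 * Real.pi / r : ℝ) * Complex.I) := by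
      rw [rootOfUnity]
      push_cast
      ring_nf
    rw [hexp, Complex.norm_exp_ofReal_mul_I]
  rw [walshPhase, norm_prod]
  exact Finset.prod_eq_one fun j _ => by rw [norm_pow, hroot, one_pow]

theorem sum_norm_coeff_primeProduct (hM : 1 ≤ M) (hρ : ∀ j, ρ j ≤ 1) (X : ℝ) (β : ℕ → ℂ)
    (hL : 1 ≤ L) :
    ∑ i : MultiIndex ρ L, ‖coeff ρ X β (primeProduct ρ L i)‖ =
      (∏ j, (size ρ L j : ℝ)) * (‖β L‖ * 2 ^ (-(X * L))) := by
  have hnorm (i : MultiIndex ρ L) :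
      ‖coeff ρ X β (primeProduct ρ L i)‖ = ‖β L‖ * 2 ^ (-(X * L)) := by
    rw [coeff_primeProduct hM hρ X β hL, norm_mul, norm_mul, norm_walshPhase, mul_one,
      Complex.norm_real, Real.norm_of_nonneg (by positivity)]
  simp only [hnorm, Finset.sum_const, nsmul_eq_mul]
  simp

theorem half_two_rpow_le_sqrt_size {j : Fin M} (hρ : 0 ≤ ρ j) :
    (2 : ℝ) ^ (ρ j * L / 2) / 2 ≤ √(size ρ L j) := by
  have hone : (1 : ℝ) ≤ size ρ L j :=
    Nat.one_le_cast.2 <| Nat.le_floor <| by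
      simpa using Real.one_le_rpow one_le_two (mul_nonneg hρ L.cast_nonneg)
  have hlt : (2 : ℝ) ^ (ρ j * L) < size ρ L j + 1 := Nat.lt_floor_add_one _
  refine Real.le_sqrt_of_sq_le ?_
  rw [div_pow, ← Real.rpow_natCast, ← Real.rpow_mul zero_le_two, Nat.cast_ofNat,
    div_mul_cancel₀ _ two_ne_zero]
  linarith

theorem two_rpow_le_sqrt_size_mul_prod (hρ : ∀ j, 0 ≤ ρ j) (k : Fin M) :
    (2 : ℝ) ^ ((∑ j, ρ j + ρ k) / 2 * L) ≤
      2 ^ (M + 1) * (√(size ρ L k) * ∏ j, √(size ρ L j)) := by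
  have hsplit : (2 : ℝ) ^ ((∑ j, ρ j + ρ k) / 2 * L) =
      2 ^ (ρ k * L / 2) * ∏ j, (2 : ℝ) ^ (ρ j * L / 2) := by
    rw [← Real.rpow_sum_of_pos two_pos, ← Real.rpow_add two_pos, ← Finset.sum_div,
      ← Finset.sum_mul]
    ring_nf
  have hhalf : (2 : ℝ) ^ (ρ k * L / 2) / 2 * ∏ j, (2 : ℝ) ^ (ρ j * L / 2) / 2 ≤
      √(size ρ L k) * ∏ j, √(size ρ L j) := by
    gcongr <;> exact half_two_rpow_le_sqrt_size (hρ _)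
  rw [Finset.prod_div_distrib, Finset.prod_const, Finset.card_univ, Fintype.card_fin] at hhalf
  rw [hsplit, ← div_le_iff₀' (by positivity), pow_succ']
  exact (mul_div_mul_comm ..).trans_le hhalf

theorem rpow_pow_mul_sqrt_size_mul_prod_le {m : ℕ} {ρ : Fin (m + 1) → ℝ}
    (hρ : ∀ j, ρ j ∈ Set.Icc 0 1) (k : Fin (m + 1)) {X : ℝ} {β : ℕ → ℂ} (hL : 1 ≤ L)
    (hβ : 1 ≤ ‖β L‖) {σ δ C : ℝ} {f : ℂ → ℂ} (h : HasBoundedSum (coeff ρ X β) σ C f) (hδ : 0 ≤ δ)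
    (hσ : σ + δ < 0) :
    (((2 ^ L : ℕ) : ℝ) ^ δ) ^ (m + 1) * (√(size ρ L k) * ∏ j, √(size ρ L j)) ≤
      2 ^ (m + 1) * 4 ^ m * C * 2 ^ (X * L) := by
  have hρ₁ (j : Fin (m + 1)) : ρ j ≤ 1 := (hρ j).2
  have hM : 1 ≤ m + 1 := Nat.le_add_left 1 m
  let P : ℝ := ∏ j, √(size ρ L (k.succAbove j))
  have hP : 0 < P := Finset.prod_pos fun j _ =>
    lt_of_lt_of_le (by positivity) (half_two_rpow_le_sqrt_size (hρ _).1)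
  have hsplit : ∏ j, √(size ρ L j) = √(size ρ L k) * P := Fin.prod_univ_succAbove _ k
  have hsize : ∏ j, (size ρ L j : ℝ) = (√(size ρ L k) * P) ^ 2 := by
    simp only [← hsplit, ← Finset.prod_pow, Real.sq_sqrt (Nat.cast_nonneg _)]
  have hnorm : ∑ i : MultiIndex ρ L, ‖coeff ρ X β (∏ j, levelPrime ρ L ⟨j, i j⟩)‖ =
      (√(size ρ L k) * P) ^ 2 * (‖β L‖ * 2 ^ (-(X * L))) :=
    hsize ▸ sum_norm_coeff_primeProduct hM hρ₁ X β hL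
  have hform := h.pow_mul_sum_norm_le (p := levelPrime ρ L) hδ hσ (levelPrime_injective hρ₁)
    levelPrime_prime two_pow_le_levelPrime
    (fun _ hA => coeff_prod_levelPrime_eq_zero hM hρ₁ X β hA) k
  simp only [Fintype.card_fin, Finset.prod_mul_distrib, Finset.prod_const, Finset.card_univ]
    at hform
  rw [hnorm, Real.rpow_neg zero_le_two, div_pow] at hform
  rw [hsplit]
  refine le_of_mul_le_mul_right ?_ hP
  calc (((2 ^ L : ℕ) : ℝ) ^ δ) ^ (m + 1) * (√(size ρ L k) * (√(size ρ L k) * P)) * P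
      = (((2 ^ L : ℕ) : ℝ) ^ δ) ^ (m + 1) * (√(size ρ L k) * P) ^ 2 * 1 := by ring
    _ ≤ (((2 ^ L : ℕ) : ℝ) ^ δ) ^ (m + 1) * (√(size ρ L k) * P) ^ 2 * ‖β L‖ := by gcongr
    _ = 2 ^ (m + 1) * 2 ^ (X * L) * ((((2 ^ L : ℕ) : ℝ) ^ δ) ^ (m + 1) / 2 ^ (m + 1) *
          ((√(size ρ L k) * P) ^ 2 * (‖β L‖ * (2 ^ (X * L))⁻¹))) := by field_simp
    _ ≤ 2 ^ (m + 1) * 2 ^ (X * L) * (4 ^ m * P * C) := by gcongr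
    _ = 2 ^ (m + 1) * 4 ^ m * C * 2 ^ (X * L) * P := by ring

theorem rpow_pow_le_of_hasBoundedSum {m : ℕ} {ρ : Fin (m + 1) → ℝ} (hρ : ∀ j, ρ j ∈ Set.Icc 0 1)
    (k : Fin (m + 1)) {X : ℝ} (hX : X ≤ (∑ j, ρ j + ρ k) / 2) {β : ℕ → ℂ} (hL : 1 ≤ L)
    (hβ : 1 ≤ ‖β L‖) {σ δ C : ℝ} {f : ℂ → ℂ} (h : HasBoundedSum (coeff ρ X β) σ C f) (hδ : 0 ≤ δ)
    (hσ : σ + δ < 0) :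
    (((2 ^ L : ℕ) : ℝ) ^ δ) ^ (m + 1) ≤ 2 ^ (m + 2) * (2 ^ (m + 1) * 4 ^ m * C) := by
  refine le_of_mul_le_mul_right ?_ (show (0 : ℝ) < 2 ^ (X * L) by positivity)
  calc (((2 ^ L : ℕ) : ℝ) ^ δ) ^ (m + 1) * 2 ^ (X * L)
      ≤ (((2 ^ L : ℕ) : ℝ) ^ δ) ^ (m + 1) * 2 ^ ((∑ j, ρ j + ρ k) / 2 * L) := by
        gcongr
        exact one_le_two
    _ ≤ (((2 ^ L : ℕ) : ℝ) ^ δ) ^ (m + 1) *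
          (2 ^ (m + 2) * (√(size ρ L k) * ∏ j, √(size ρ L j))) := by
        gcongr
        exact two_rpow_le_sqrt_size_mul_prod (fun j => (hρ j).1) k
    _ = 2 ^ (m + 2) * ((((2 ^ L : ℕ) : ℝ) ^ δ) ^ (m + 1) *
          (√(size ρ L k) * ∏ j, √(size ρ L j))) := mul_left_comm _ _ _
    _ ≤ 2 ^ (m + 2) * (2 ^ (m + 1) * 4 ^ m * C * 2 ^ (X * L)) :=
        mul_le_mul_of_nonneg_left (rpow_pow_mul_sqrt_size_mul_prod_le hρ k hL hβ h hδ hσ)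
          (by positivity)
    _ = 2 ^ (m + 2) * (2 ^ (m + 1) * 4 ^ m * C) * 2 ^ (X * L) := (mul_assoc _ _ _).symm

end DirichletWalsh

theorem mul_add_one_div_two_mul_le {s x : ℝ} (hx : 0 < x) (hs : s ≤ x) :
    s * ((x + 1) / (2 * x)) ≤ (s + 1) / 2 := by
  have : (s + 1) / 2 - s * ((x + 1) / (2 * x)) = (x - s) / (2 * x) := by
    field_simp
    ring
  linarith [div_nonneg (sub_nonneg.2 hs) (mul_pos two_pos hx).le]

theorem mainTheorem3_general {M : ℕ} {ρ : Fin M → ℝ} (hρ : ∀ j, ρ j ∈ Set.Icc (0 : ℝ) 1)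
    (k : Fin M) {X : ℝ} (hX : X ≤ (∑ j, ρ j + ρ k) / 2) {β : ℕ → ℂ}
    (hβ : ∀ L, 1 ≤ L → 1 ≤ ‖β L‖) :
    0 ≤ DirichletWalsh.sigmaB (DirichletWalsh.coeff ρ X β) := by
  refine le_sInf ?_
  rintro _ ⟨σ, ⟨f, C, hf⟩, rfl⟩
  by_contra hneg
  have hσ : σ < 0 := not_le.1 fun h => hneg (EReal.coe_nonneg.2 h)
  obtain ⟨m, rfl⟩ := Nat.exists_eq_succ_of_ne_zero k.pos.ne'
  obtain ⟨δ, hδ, hδσ⟩ := exists_between (neg_pos.2 hσ)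
  have hbase : 1 < ((2 : ℝ) ^ δ) ^ (m + 1) :=
    one_lt_pow₀ (Real.one_lt_rpow one_lt_two hδ) m.succ_ne_zero
  obtain ⟨L, hL⟩ := pow_unbounded_of_one_lt (2 ^ (m + 2) * (2 ^ (m + 1) * 4 ^ m * C)) hbase
  refine (hL.trans_le (pow_le_pow_right₀ hbase.le L.le_succ)).not_ge ?_
  have hle := DirichletWalsh.rpow_pow_le_of_hasBoundedSum hρ k hX L.succ_pos (hβ _ L.succ_pos)
    hf hδ.le (lt_neg_iff_add_neg'.1 hδσ)
  rwa [Nat.cast_pow, Nat.cast_ofNat, ← Real.rpow_natCast_mul zero_le_two, mul_comm (_ : ℝ) δ,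
    Real.rpow_mul_natCast zero_le_two, pow_right_comm] at hle

theorem mainTheorem3 (M : ℕ) (hM : 1 ≤ M) (ρ : Fin M → ℝ)
    (hρ_mono : Monotone ρ) (hρ_mem : ∀ j, ρ j ∈ Set.Icc (0 : ℝ) 1)
    (hρ_last : ρ ⟨M - 1, by omega⟩ = 1)
    (X : ℝ) (hX : X = (∑ j, ρ j) * (((M : ℝ) + 1) / (2 * (M : ℝ))))
    (β : ℕ → ℂ) (hβ : ∀ L, 1 ≤ L → ‖β L‖ = 1) :
    0 ≤ DirichletWalsh.sigmaB (DirichletWalsh.coeff ρ X β) := by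
  have hsum : ∑ j, ρ j ≤ M := by
    simpa using Finset.sum_le_card_nsmul Finset.univ ρ 1 fun j _ => (hρ_mem j).2
  refine mainTheorem3_general hρ_mem ⟨M - 1, by omega⟩ ?_ fun L hL => (hβ L hL).ge
  rw [hX, hρ_last]
  exact mul_add_one_div_two_mul_le (by positivity) hsum
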